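/- Let $d \ge 1$ be an integer and let $1 \le p < \infty$. For a box $I = [a_1,b_1]\times\dots\times[a_d,b_d]\subset\mathbb{R}^d$ and $B>0$ let $\mathcal{C}_p(I,B)$ be the class of all convex functions $f$ on $I$ with $\int_I |f(x)|^p\,dx \le B^p$. For a class $\mathcal{F}$ of functions and a box $J$, let $M(\mathcal{F},\epsilon;L_p(J))$ be the smallest number of closed balls of radius $\epsilon$ in $L_p(J)$ (that is, with respect to the pseudometric $(\int_J |f-g|^p\,dx)^{1/p}$) whose union contains $\mathcal{F}$, with value $\infty$ if no finite number suffices. There exists a constant $c>0$ depending only on $d$ and $p$ such that for all boxes $I = [a_1,b_1]\times\dots\times[a_d,b_d]$ and $J = [\alpha_1,\beta_1]\times\dots\times[\alpha_d,\beta_d]$ with $a_i<\alpha_i<\beta_i<b_i$ for $i=1,\dots,d$, all $B>0$ and all $\epsilon>0$, $$\log M(\mathcal{C}_p(I,B),\epsilon;L_p(J)) \le c\left(\frac{\epsilon}{B}\right)^{-d/2}\left(\log\frac1\eta\right)^{d(2p+d)/(2p)},$$ where $$\eta := \min_{1\le i\le d}\min\left(\frac{\alpha_i-a_i}{b_i-a_i},\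 \frac{b_i-\beta_i}{b_i-a_i}\right).$$ In particular, the left-hand side is finite. -/

import Mathlib

open MeasureTheory
open scoped ENNReal

/-- The class `C_p(I, B)`: real functions that are convex on `I` and satisfy
`∫_I |f(x)|^p dx ≤ B^p`. Values outside `I` are irrelevant. The lower Lebesgue integral is used, so
that a function with `∫_I |f|^p = ∞` is not in the class. -/
def convexClass {d : ℕ} (p : ℝ) (I : Set (Fin d → ℝ)) (B : ℝ) : Set ((Fin d → ℝ) → ℝ) :=
  {f | ConvexOn ℝ I f ∧
    ∫⁻ x in I, ENNReal.ofReal (|f x| ^ p) ≤ ENNReal.ofReal (B ^ p)}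

/-- `C` is an `ε`-net for `F` in the `L_p(J)` pseudometric: the closed `L_p(J)`-balls of radius `ε`
centred at the members of `C`, all of which lie in the space `L_p(J)`, cover `F`. -/
def IsLpCover {d : ℕ} (p : ℝ) (J : Set (Fin d → ℝ)) (F : Set ((Fin d → ℝ) → ℝ)) (ε : ℝ)
    (C : Set ((Fin d → ℝ) → ℝ)) : Prop :=
  (∀ g ∈ C, MemLp g (ENNReal.ofReal p) (volume.restrict J)) ∧
  ∀ f ∈ F, ∃ g ∈ C,
    eLpNorm (f - g) (ENNReal.ofReal p) (volume.restrict J) ≤ ENNReal.ofReal ε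

/-- The covering number `M(F, ε; L_p(J))`: the smallest number of closed balls of radius `ε` in
`L_p(J)` whose union contains `F` (`⊤` if there is no finite cover). -/
noncomputable def lpCoveringNumber {d : ℕ} (F : Set ((Fin d → ℝ) → ℝ)) (ε p : ℝ)
    (J : Set (Fin d → ℝ)) : ℕ∞ :=
  ⨅ (C : Set ((Fin d → ℝ) → ℝ)) (_ : IsLpCover p J F ε C), C.encard

/-- The metric entropy `log M(F, ε; L_p(J))`, with `log ∞ = ∞`. -/
noncomputable def lpMetricEntropy {d : ℕ} (F : Set ((Fin d → ℝ) → ℝ)) (ε p : ℝ)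
    (J : Set (Fin d → ℝ)) : EReal :=
  ENNReal.log (lpCoveringNumber F ε p J : ℝ≥0∞)

/-- The minimal relative distance, over all coordinates and both sides, from the box `[α, β]` to the
boundary of the box `[a, b]` (a minimum over a finite set, non-empty for `d ≥ 1`). -/
noncomputable def relDist {d : ℕ} (a b α β : Fin d → ℝ) : ℝ :=
  ⨅ i, min ((α i - a i) / (b i - a i)) ((b i - β i) / (b i - a i))

/-!
Every point `x` of a box has a small `u` such that a given convex `f` is controlled by its `L_p`
norm at `x + u`, `x - u` and `x + 2 u`, so that `f x` is controlled as well. Hence, if the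
concentric box three times as large lies in `I`, then `f` is uniformly bounded on the box in terms
of its `L_p` norm and the volume of the box, and can be rescaled to a convex function bounded by
one near the unit cube.

The Moreau envelope of such a function on the cube has second differences between `0` and `δ ^ 2`
on a grid of mesh `δ`. Rounded down to multiples of `δ ^ 2` it is therefore determined by
boundedly many choices per grid point, that is, by one of at most `exp (C δ ^ (-d))` codes. The
envelope in turn determines the function up to a multiple of `δ ^ 2`: if `ξ` is a subgradient at
`x`, then the envelope near `x + ξ` gives back the value at `x`. Encoding costs the same for all
boxes, and since the uniform bound is inversely proportional to the `p`-th root of the volume, all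
boxes contribute equally to the `L_p` error.

Dyadic intervals, as long as they are distant from the boundary, cover `[α_i, β_i]` by
`O(log (1 / η))` intervals, so `n = O(log (1 / η)) ^ d` boxes are enough. With `δ ^ 2` proportional
to `ε / (B n ^ (1 / p))` the total entropy is at most of order
`n δ ^ (-d)`, that is, `(ε / B) ^ (-d / 2) n ^ (1 + d / (2 p))`.
-/

section Subgradient

open scoped RealInnerProductSpace

lemma exists_continuousLinearMap_add_le_of_convexOn {E : Type*} [AddCommGroup E] [Module ℝ E]
    [TopologicalSpace E] [IsTopologicalAddGroup E] [ContinuousSMul ℝ E] {U : Set E} {f : E → ℝ}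
    (hU : IsOpen U) (hf : ConvexOn ℝ U f) (hcont : ContinuousOn f U) {x : E} (hx : x ∈ U) :
    ∃ l : E →L[ℝ] ℝ, ∀ y ∈ U, f x + l (y - x) ≤ f y := by
  have hopen : IsOpen {q : E × ℝ | q.1 ∈ U ∧ f q.1 < q.2} := by
    have hgap : ContinuousOn (fun q : E × ℝ => q.2 - f q.1) (Prod.fst ⁻¹' U) :=
      continuousOn_snd.sub (hcont.comp continuousOn_fst fun _ hq => hq)
    convert hgap.isOpen_inter_preimage (hU.preimage continuous_fst) isOpen_Ioi (t := Set.Ioi 0)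
      using 1
    ext q
    simp
  obtain ⟨φ, hφ⟩ := geometric_hahn_banach_open_point (x := (x, f x)) hf.convex_strict_epigraph
    hopen (by simp)
  have hsplit : ∀ y t, φ (y, t) = φ (y, 0) + t * φ (0, 1) := fun y t => by
    rw [← smul_eq_mul, ← map_smul, ← map_add]
    simp
  have hslope : φ (0, 1) < 0 := by
    have hup := hφ (x, f x + 1) ⟨hx, lt_add_one _⟩
    rw [hsplit x (f x), hsplit x (f x + 1)] at hup
    linarith
  refine ⟨(-φ (0, 1))⁻¹ • φ.comp (ContinuousLinearMap.inl ℝ E ℝ), fun y hy => ?_⟩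
  refine le_of_forall_pos_le_add fun ε hε => ?_
  have hbelow := hφ (y, f y + ε) ⟨hy, lt_add_of_pos_right _ hε⟩
  have hdiff : φ (y - x, 0) = φ (y, 0) - φ (x, 0) := by
    rw [← map_sub]
    simp
  rw [hsplit y, hsplit x] at hbelow
  simp only [smul_apply, ContinuousLinearMap.comp_apply, ContinuousLinearMap.inl_apply,
    smul_eq_mul, hdiff]
  rw [← le_sub_iff_add_le', inv_mul_le_iff₀ (neg_pos.2 hslope)]
  linarith

lemma exists_subgradient_norm_le {E : Type*} [NormedAddCommGroup E] [InnerProductSpace ℝ E]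
    [CompleteSpace E] {U : Set E} {f : E → ℝ} (hU : IsOpen U) (hf : ConvexOn ℝ U f)
    (hcont : ContinuousOn f U) {x : E} {r M : ℝ} (hr : 0 < r) (hball : Metric.closedBall x r ⊆ U)
    (hM : ∀ y ∈ Metric.closedBall x r, f y - f x ≤ M) :
    ∃ ξ : E, ‖ξ‖ ≤ M / r ∧ ∀ y ∈ U, f x + ⟪ξ, y - x⟫ ≤ f y := by
  have hxr : x ∈ Metric.closedBall x r := Metric.mem_closedBall_self hr.le
  obtain ⟨l, hl⟩ := exists_continuousLinearMap_add_le_of_convexOn hU hf hcont (hball hxr)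
  set ξ : E := (InnerProductSpace.toDual ℝ E).symm l
  have hξ : ∀ y ∈ U, f x + ⟪ξ, y - x⟫ ≤ f y := fun y hy => by
    simpa only [ξ, InnerProductSpace.toDual_symm_apply] using hl y hy
  refine ⟨ξ, ?_, hξ⟩
  rw [le_div_iff₀ hr]
  rcases eq_or_ne ξ 0 with h0 | h0
  · simpa [h0] using hM x hxr
  have hn : 0 < ‖ξ‖ := norm_pos_iff.2 h0
  have hy : x + (r / ‖ξ‖) • ξ ∈ Metric.closedBall x r := by
    rw [mem_closedBall_iff_norm, add_sub_cancel_left, norm_smul,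
      Real.norm_of_nonneg (by positivity), div_mul_cancel₀ _ hn.ne']
  have hinner : ⟪ξ, x + (r / ‖ξ‖) • ξ - x⟫ = ‖ξ‖ * r := by
    rw [add_sub_cancel_left, real_inner_smul_right, real_inner_self_eq_norm_sq]
    field_simp
  linarith [hξ _ (hball hy), hM _ hy]

end Subgradient

/-- The Moreau envelope of the restriction of `h` to `S`, with parameter one. If `h` is not bounded
below on `S`, or `S` is empty, then it takes junk values. -/
noncomputable def moreauEnv {E : Type*} [NormedAddCommGroup E] (S : Set E) (h : E → ℝ) (z : E) :
    ℝ :=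
  ⨅ y : S, (h y + ‖(y : E) - z‖ ^ 2 / 2)

section MoreauEnvelope

open scoped RealInnerProductSpace

variable {E : Type*} [NormedAddCommGroup E] {S : Set E} {h h' : E → ℝ}

lemma moreauEnv_le (hb : BddBelow (h '' S)) {y : E} (hy : y ∈ S) (z : E) :
    moreauEnv S h z ≤ h y + ‖y - z‖ ^ 2 / 2 := by
  obtain ⟨m, hm⟩ := hb
  refine ciInf_le (f := fun y : S => h y + ‖(y : E) - z‖ ^ 2 / 2) ⟨m, ?_⟩ ⟨y, hy⟩
  rintro _ ⟨w, rfl⟩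
  have hw : m ≤ h w := hm ⟨w, w.2, rfl⟩
  exact hw.trans (le_add_of_nonneg_right (by positivity))

lemma le_moreauEnv (hS : S.Nonempty) {z : E} {r : ℝ}
    (hr : ∀ y ∈ S, r ≤ h y + ‖y - z‖ ^ 2 / 2) : r ≤ moreauEnv S h z := by
  have := hS.to_subtype
  exact le_ciInf fun y => hr y y.2

lemma abs_moreauEnv_le {M : ℝ} (hM : ∀ y ∈ S, |h y| ≤ M) {y : E} (hy : y ∈ S) (z : E) :
    |moreauEnv S h z| ≤ M + ‖y - z‖ ^ 2 / 2 := by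
  have hb : BddBelow (h '' S) := ⟨-M, by
    rintro _ ⟨w, hw, rfl⟩
    exact (abs_le.1 (hM w hw)).1⟩
  rw [abs_le]
  constructor
  · refine le_moreauEnv ⟨y, hy⟩ fun w hw => ?_
    linarith [(abs_le.1 (hM w hw)).1, sq_nonneg ‖y - z‖, sq_nonneg ‖w - z‖]
  · linarith [moreauEnv_le hb hy z, (abs_le.1 (hM y hy)).2]

variable [InnerProductSpace ℝ E]

lemma moreauEnv_add_add_moreauEnv_sub_le (hS : S.Nonempty) (hb : BddBelow (h '' S)) (z s : E) :
    moreauEnv S h (z + s) + moreauEnv S h (z - s) ≤ 2 * moreauEnv S h z + ‖s‖ ^ 2 := by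
  suffices (moreauEnv S h (z + s) + moreauEnv S h (z - s) - ‖s‖ ^ 2) / 2 ≤ moreauEnv S h z by
    linarith
  refine le_moreauEnv hS fun y hy => ?_
  have hlaw := parallelogram_law_with_norm ℝ (y - z) s
  rw [sub_add, sub_sub] at hlaw
  linarith [moreauEnv_le hb hy (z + s), moreauEnv_le hb hy (z - s)]

lemma two_mul_moreauEnv_le (hS : S.Nonempty) (hb : BddBelow (h '' S)) (hh : ConvexOn ℝ S h)
    (z s : E) : 2 * moreauEnv S h z ≤ moreauEnv S h (z + s) + moreauEnv S h (z - s) := by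
  suffices 2 * moreauEnv S h z - moreauEnv S h (z - s) ≤ moreauEnv S h (z + s) by linarith
  refine le_moreauEnv hS fun y hy => ?_
  suffices 2 * moreauEnv S h z - (h y + ‖y - (z + s)‖ ^ 2 / 2) ≤ moreauEnv S h (z - s) by linarith
  refine le_moreauEnv hS fun w hw => ?_
  have hhalf : (0 : ℝ) ≤ 1 / 2 := by norm_num
  have hmid := hh.2 hy hw hhalf hhalf (add_halves 1)
  have henv := moreauEnv_le hb (hh.1 hy hw hhalf hhalf (add_halves 1)) z
  have hsum : y - (z + s) + (w - (z - s)) =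
      (2 : ℝ) • ((1 / 2 : ℝ) • y + (1 / 2 : ℝ) • w - z) := by module
  have hlaw := parallelogram_law_with_norm ℝ (y - (z + s)) (w - (z - s))
  rw [hsum, norm_smul, Real.norm_two, mul_pow] at hlaw
  simp only [smul_eq_mul] at hmid
  linarith [sq_nonneg ‖y - (z + s) - (w - (z - s))‖]

lemma le_moreauEnv_of_subgradient {x ξ : E} (hx : x ∈ S)
    (hξ : ∀ y ∈ S, h x + ⟪ξ, y - x⟫ ≤ h y) (z : E) :
    h x + ‖x - z‖ ^ 2 / 2 - ‖x + ξ - z‖ ^ 2 / 2 ≤ moreauEnv S h z := by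
  refine le_moreauEnv ⟨x, hx⟩ fun y hy => ?_
  have hsq : ‖y - z‖ ^ 2 = ‖y - x‖ ^ 2 + 2 * ⟪y - x, x - z⟫ + ‖x - z‖ ^ 2 := by
    rw [← norm_add_sq_real, sub_add_sub_cancel]
  have hcomplete : ‖y - x + (x + ξ - z)‖ ^ 2 =
      ‖y - x‖ ^ 2 + 2 * (⟪y - x, x - z⟫ + ⟪ξ, y - x⟫) + ‖x + ξ - z‖ ^ 2 := by
    rw [norm_add_sq_real, real_inner_comm, add_sub_right_comm, inner_add_left,
      real_inner_comm (y - x)]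
  linarith [hξ y hy, sq_nonneg ‖y - x + (x + ξ - z)‖]

/- The envelope of a convex function at `x + ξ` is attained at `x`, so its values near `x + ξ`
recover the value of the function at `x`. -/
lemma sub_le_of_subgradient (hb' : BddBelow (h' '' S)) {x ξ : E} (hx : x ∈ S)
    (hξ : ∀ y ∈ S, h x + ⟪ξ, y - x⟫ ≤ h y) (z : E) :
    h x - h' x ≤ moreauEnv S h z - moreauEnv S h' z + ‖x + ξ - z‖ ^ 2 / 2 := by
  linarith [le_moreauEnv_of_subgradient hx hξ z, moreauEnv_le hb' hx z]

end MoreauEnvelope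

section ForwardDifference

lemma eq_of_fwdDiff_fwdDiff_eq {ι R : Type*} [Finite ι] [DecidableEq ι] [AddCommGroup R]
    {G G' : (ι → ℕ) → R} {N : ℕ} (h0 : ∀ k : ι → ℕ, (∀ i, k i < 2) → G k = G' k)
    (h2 : ∀ i (k : ι → ℕ), (∀ j, k j < N) → fwdDiff (Pi.single i 1) (fwdDiff (Pi.single i 1) G) k =
      fwdDiff (Pi.single i 1) (fwdDiff (Pi.single i 1) G') k)
    {k : ι → ℕ} (hk : ∀ i, k i < N) : G k = G' k := by
  have := Fintype.ofFinite ι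
  induction hn : ∑ i, k i using Nat.strong_induction_on generalizing k with
  | _ n ih =>
    by_cases hsmall : ∀ i, k i < 2
    · exact h0 k hsmall
    push Not at hsmall
    obtain ⟨i, hi⟩ := hsmall
    set e : ι → ℕ := Pi.single i 1
    have hsum : ∑ j, e j = 1 := Finset.sum_pi_single' i 1 Finset.univ |>.trans (by simp)
    obtain ⟨m, rfl⟩ : ∃ m, k = m + e + e := by
      refine ⟨k - (e + e), ?_⟩
      rw [add_assoc, tsub_add_cancel_of_le]
      intro j
      rcases eq_or_ne j i with rfl | hj
      · simpa [e] using hi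
      · simp [e, hj]
    have hdiff := h2 i m fun j => lt_of_le_of_lt (by simp [add_assoc]) (hk j)
    have hmid : G (m + e) = G' (m + e) :=
      ih _ (by simp [← hn, Finset.sum_add_distrib, hsum])
        (fun j => lt_of_le_of_lt (Nat.le_add_right _ _) (hk j)) rfl
    have hlow : G m = G' m :=
      ih _ (by simp [← hn, Finset.sum_add_distrib, hsum])
        (fun j => lt_of_le_of_lt (by simp [add_assoc]) (hk j)) rfl
    simpa [fwdDiff, e, hmid, hlow] using hdiff

lemma floor_sub_two_mul_floor_add_floor_mem {a b c : ℝ} (h0 : 0 ≤ a - 2 * b + c)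
    (h1 : a - 2 * b + c ≤ 1) : ⌊a⌋ - 2 * ⌊b⌋ + ⌊c⌋ ∈ Finset.Icc (-1 : ℤ) 2 := by
  have ha := Int.floor_le a
  have ha' := Int.lt_floor_add_one a
  have hb := Int.floor_le b
  have hb' := Int.lt_floor_add_one b
  have hc := Int.floor_le c
  have hc' := Int.lt_floor_add_one c
  have hlow : (-2 : ℝ) < (⌊a⌋ - 2 * ⌊b⌋ + ⌊c⌋ : ℤ) := by
    push_cast
    linarith
  have hhigh : ((⌊a⌋ - 2 * ⌊b⌋ + ⌊c⌋ : ℤ) : ℝ) < 3 := by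
    push_cast
    linarith
  have hlow' : -2 < ⌊a⌋ - 2 * ⌊b⌋ + ⌊c⌋ := by exact_mod_cast hlow
  have hhigh' : ⌊a⌋ - 2 * ⌊b⌋ + ⌊c⌋ < 3 := by exact_mod_cast hhigh
  rw [Finset.mem_Icc]
  lia

lemma abs_floor_le_natCeil {x r : ℝ} (h : |x| ≤ r) : |⌊x⌋| ≤ ⌈r⌉₊ := by
  have hr : r ≤ ⌈r⌉₊ := Nat.le_ceil r
  obtain ⟨hlow, hhigh⟩ := abs_le.1 (h.trans hr)
  rw [abs_le]
  constructor
  · exact Int.le_floor.2 (by exact_mod_cast hlow)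
  · exact_mod_cast (Int.floor_le x).trans hhigh

end ForwardDifference

/-- The closed unit cube in Euclidean space. -/
def unitCube (d : ℕ) : Set (EuclideanSpace ℝ (Fin d)) :=
  {x | ∀ i, x i ∈ Set.Icc (0 : ℝ) 1}

/-- The functions that are convex and bounded by one on a fixed neighbourhood of the unit cube. All
their subgradients at points of the cube have norm at most eight. -/
def IsNormalizedConvex {d : ℕ} (h : EuclideanSpace ℝ (Fin d) → ℝ) : Prop :=
  ConvexOn ℝ (Metric.thickening (1 / 2) (unitCube d)) h ∧
    ∀ x ∈ Metric.thickening (1 / 2) (unitCube d), |h x| ≤ 1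

/-- The points of the grid with mesh `δ` whose smallest corner is `(-8, …, -8)`. -/
noncomputable def gridPoint {d : ℕ} (δ : ℝ) (k : Fin d → ℕ) : EuclideanSpace ℝ (Fin d) :=
  WithLp.toLp 2 fun i => -8 + δ * k i

/-- The number of grid points in each direction needed to get from `-8` to `9`, so that the grid
covers all points `x + ξ` with `x` in the unit cube and `‖ξ‖ ≤ 8`. -/
noncomputable def gridSize (δ : ℝ) : ℕ := ⌊17 / δ⌋₊ + 1

/-- The values of the Moreau envelope of `h` on the grid of mesh `δ`, rounded down to multiples of
`δ ^ 2` and expressed in this unit. -/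
noncomputable def quantizedEnv {d : ℕ} (δ : ℝ) (h : EuclideanSpace ℝ (Fin d) → ℝ)
    (k : Fin d → ℕ) : ℤ :=
  ⌊moreauEnv (unitCube d) h (gridPoint δ k) / δ ^ 2⌋

/-- The data by which a normalized convex function is encoded: the second differences of its
quantized envelope in the coordinate directions, and the values of that envelope on `{0, 1}^d`. -/
noncomputable def convexCode {d : ℕ} (δ : ℝ) (h : EuclideanSpace ℝ (Fin d) → ℝ) :
    (Fin d × (Fin d → Fin (gridSize δ)) → ℤ) × ((Fin d → Fin 2) → ℤ) :=
  (fun q => fwdDiff (Pi.single q.1 1) (fwdDiff (Pi.single q.1 1) (quantizedEnv δ h))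
      fun i => (q.2 i : ℕ),
    fun k => quantizedEnv δ h fun i => (k i : ℕ))

/-- The finite set in which the codes of normalized convex functions lie when `0 < δ ≤ 1`. -/
noncomputable def codeSet (d : ℕ) (δ : ℝ) :
    Finset ((Fin d × (Fin d → Fin (gridSize δ)) → ℤ) × ((Fin d → Fin 2) → ℤ)) :=
  Fintype.piFinset (fun _ => Finset.Icc (-1) 2) ×ˢ
    Fintype.piFinset fun _ => Finset.Icc (-(⌈(1 + 32 * d) / δ ^ 2⌉₊ : ℤ)) ⌈(1 + 32 * d) / δ ^ 2⌉₊

section Code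

open scoped RealInnerProductSpace

variable {d : ℕ} {δ : ℝ} {h h' : EuclideanSpace ℝ (Fin d) → ℝ}

lemma gridPoint_add_single (k : Fin d → ℕ) (i : Fin d) :
    gridPoint δ (k + Pi.single i 1) = gridPoint δ k + EuclideanSpace.single i δ := by
  ext j
  rcases eq_or_ne j i with rfl | hj
  · simp only [gridPoint, PiLp.add_apply, Pi.add_apply, Pi.single_eq_same, EuclideanSpace.single,
      PiLp.single_apply, if_true]
    push_cast
    ring
  · simp [gridPoint, hj]

lemma exists_norm_sub_gridPoint_sq_le (hδ : 0 < δ) {w : EuclideanSpace ℝ (Fin d)}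
    (hw : ∀ i, w i ∈ Set.Icc (-8 : ℝ) 9) :
    ∃ k : Fin d → ℕ, (∀ i, k i < gridSize δ) ∧ ‖w - gridPoint δ k‖ ^ 2 ≤ d * δ ^ 2 := by
  refine ⟨fun i => ⌊(w i + 8) / δ⌋₊, fun i => ?_, ?_⟩
  · refine Nat.lt_succ_of_le (Nat.floor_le_floor ?_)
    gcongr
    linarith [(hw i).2]
  · have hcoord : ∀ i, ‖(w - gridPoint δ fun i => ⌊(w i + 8) / δ⌋₊) i‖ ^ 2 ≤ δ ^ 2 := fun i => by
      have hpos : 0 ≤ (w i + 8) / δ := div_nonneg (by linarith [(hw i).1]) hδ.le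
      have hlow := (le_div_iff₀ hδ).1 (Nat.floor_le hpos)
      have hhigh := (div_lt_iff₀ hδ).1 (Nat.lt_floor_add_one ((w i + 8) / δ))
      rw [Real.norm_eq_abs, sq_abs]
      refine sq_le_sq' ?_ ?_ <;> simp only [gridPoint, PiLp.sub_apply] <;> linarith
    rw [EuclideanSpace.norm_sq_eq]
    simpa using Finset.sum_le_sum fun i (_ : i ∈ Finset.univ) => hcoord i

lemma zero_mem_unitCube : (0 : EuclideanSpace ℝ (Fin d)) ∈ unitCube d := by
  simp [unitCube]

lemma unitCube_subset_thickening : unitCube d ⊆ Metric.thickening (1 / 2) (unitCube d) :=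
  Metric.self_subset_thickening one_half_pos _

lemma convex_unitCube : Convex ℝ (unitCube d) := by
  have hpre : unitCube d = (WithLp.linearEquiv 2 ℝ (Fin d → ℝ)) ⁻¹' Set.Icc 0 1 := by
    ext x
    simp only [unitCube, Set.mem_ofPred_eq, Set.mem_Icc, Set.mem_preimage, Pi.le_def, forall_and]
    rfl
  rw [hpre]
  exact (convex_Icc _ _).linear_preimage (WithLp.linearEquiv 2 ℝ (Fin d → ℝ)).toLinearMap

lemma IsNormalizedConvex.abs_le_one (hh : IsNormalizedConvex h) :
    ∀ x ∈ unitCube d, |h x| ≤ 1 :=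
  fun _ hx => hh.2 _ (unitCube_subset_thickening hx)

lemma IsNormalizedConvex.bddBelow (hh : IsNormalizedConvex h) : BddBelow (h '' unitCube d) :=
  ⟨-1, by
    rintro _ ⟨x, hx, rfl⟩
    exact (abs_le.1 (hh.abs_le_one x hx)).1⟩

lemma IsNormalizedConvex.convexOn_unitCube (hh : IsNormalizedConvex h) :
    ConvexOn ℝ (unitCube d) h :=
  hh.1.subset unitCube_subset_thickening convex_unitCube

lemma IsNormalizedConvex.exists_subgradient (hh : IsNormalizedConvex h)
    {x : EuclideanSpace ℝ (Fin d)} (hx : x ∈ unitCube d) :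
    ∃ ξ : EuclideanSpace ℝ (Fin d), ‖ξ‖ ≤ 8 ∧ ∀ y ∈ unitCube d, h x + ⟪ξ, y - x⟫ ≤ h y := by
  have hball : Metric.closedBall x (1 / 4) ⊆ Metric.thickening (1 / 2) (unitCube d) := fun y hy =>
    Metric.mem_thickening_iff.2 ⟨x, hx, hy.trans_lt (by norm_num)⟩
  obtain ⟨ξ, hnorm, hξ⟩ := exists_subgradient_norm_le (M := 2) Metric.isOpen_thickening hh.1
    (hh.1.continuousOn Metric.isOpen_thickening) (by norm_num) hball fun y hy => by
      linarith [(abs_le.1 (hh.2 y (hball hy))).2, (abs_le.1 (hh.abs_le_one x hx)).1]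
  exact ⟨ξ, hnorm.trans (by norm_num), fun y hy => hξ y (unitCube_subset_thickening hy)⟩

lemma fwdDiff_fwdDiff_quantizedEnv_mem (hδ : 0 < δ) (hh : IsNormalizedConvex h) (i : Fin d)
    (k : Fin d → ℕ) :
    fwdDiff (Pi.single i 1) (fwdDiff (Pi.single i 1) (quantizedEnv δ h)) k ∈
      Finset.Icc (-1 : ℤ) 2 := by
  set s : EuclideanSpace ℝ (Fin d) := EuclideanSpace.single i δ
  set z := gridPoint δ k + s
  have hs : ‖s‖ ^ 2 = δ ^ 2 := by simp [s]
  have hz : gridPoint δ k = z - s := (add_sub_cancel_right _ _).symm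
  have hconvex := two_mul_moreauEnv_le ⟨0, zero_mem_unitCube⟩ hh.bddBelow hh.convexOn_unitCube z s
  have hconcave := moreauEnv_add_add_moreauEnv_sub_le ⟨0, zero_mem_unitCube⟩ hh.bddBelow z s
  rw [hs] at hconcave
  have hδ2 : 0 < δ ^ 2 := by positivity
  convert floor_sub_two_mul_floor_add_floor_mem (a := moreauEnv (unitCube d) h (z + s) / δ ^ 2)
    (b := moreauEnv (unitCube d) h z / δ ^ 2)
    (c := moreauEnv (unitCube d) h (z - s) / δ ^ 2) ?_ ?_ using 1
  · simp only [fwdDiff, quantizedEnv, gridPoint_add_single, ← hz]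
    ring
  · rw [mul_div, ← sub_div, ← add_div]
    exact div_nonneg (by linarith) hδ2.le
  · rw [mul_div, ← sub_div, ← add_div, div_le_one hδ2]
    linarith

lemma abs_quantizedEnv_le (hδ : 0 < δ) (hδ1 : δ ≤ 1) (hh : IsNormalizedConvex h)
    {k : Fin d → ℕ} (hk : ∀ i, k i < 2) :
    |quantizedEnv δ h k| ≤ ⌈(1 + 32 * d) / δ ^ 2⌉₊ := by
  have hnorm : ‖0 - gridPoint δ k‖ ^ 2 ≤ 64 * d := by
    have hcoord : ∀ i, ‖(0 - gridPoint δ k) i‖ ^ 2 ≤ 64 := fun i => by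
      have hki : (k i : ℝ) ≤ 1 := by exact_mod_cast Nat.le_of_lt_succ (hk i)
      have hle : δ * k i ≤ 1 := mul_le_one₀ hδ1 (Nat.cast_nonneg _) hki
      have hnonneg : 0 ≤ δ * k i := by positivity
      simp only [gridPoint, PiLp.sub_apply, PiLp.zero_apply, Real.norm_eq_abs, sq_abs]
      nlinarith
    rw [EuclideanSpace.norm_sq_eq]
    simpa [mul_comm] using Finset.sum_le_sum fun i (_ : i ∈ Finset.univ) => hcoord i
  refine abs_floor_le_natCeil ?_
  rw [abs_div, abs_of_pos (by positivity : 0 < δ ^ 2)]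
  gcongr
  linarith [abs_moreauEnv_le hh.abs_le_one zero_mem_unitCube (gridPoint δ k)]

lemma convexCode_mem_codeSet (hδ : 0 < δ) (hδ1 : δ ≤ 1) (hh : IsNormalizedConvex h) :
    convexCode δ h ∈ codeSet d δ := by
  refine Finset.mem_product.2 ⟨Fintype.mem_piFinset.2 fun q => ?_, Fintype.mem_piFinset.2
    fun k => ?_⟩
  · exact fwdDiff_fwdDiff_quantizedEnv_mem hδ hh q.1 _
  · exact Finset.mem_Icc.2 (abs_le.1 (abs_quantizedEnv_le hδ hδ1 hh fun i => (k i).2))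

lemma quantizedEnv_eq_of_convexCode_eq (hcode : convexCode δ h = convexCode δ h')
    {k : Fin d → ℕ} (hk : ∀ i, k i < gridSize δ) : quantizedEnv δ h k = quantizedEnv δ h' k := by
  obtain ⟨hdiff, hinit⟩ := Prod.ext_iff.1 hcode
  exact eq_of_fwdDiff_fwdDiff_eq (fun k hk => congrFun hinit fun i => ⟨k i, hk i⟩)
    (fun i k hk => congrFun hdiff (i, fun j => ⟨k j, hk j⟩)) hk

lemma sub_le_of_convexCode_eq (hδ : 0 < δ) (hh : IsNormalizedConvex h)
    (hh' : IsNormalizedConvex h') (hcode : convexCode δ h = convexCode δ h')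
    {x : EuclideanSpace ℝ (Fin d)} (hx : x ∈ unitCube d) :
    h x - h' x ≤ (d + 2) / 2 * δ ^ 2 := by
  obtain ⟨ξ, hnorm, hξ⟩ := hh.exists_subgradient hx
  have hw : ∀ i, (x + ξ) i ∈ Set.Icc (-8 : ℝ) 9 := fun i => by
    have hξi := abs_le.1 ((PiLp.norm_apply_le ξ i).trans hnorm)
    rw [PiLp.add_apply]
    exact ⟨by linarith [(hx i).1], by linarith [(hx i).2]⟩
  obtain ⟨k, hk, hnear⟩ := exists_norm_sub_gridPoint_sq_le hδ hw
  have hδ2 : 0 < δ ^ 2 := by positivity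
  have henv : moreauEnv (unitCube d) h (gridPoint δ k) - moreauEnv (unitCube d) h' (gridPoint δ k) ≤
      δ ^ 2 := by
    have hfloor := (abs_lt.1 (Int.abs_sub_lt_one_of_floor_eq_floor
      (quantizedEnv_eq_of_convexCode_eq hcode hk))).2
    rw [← sub_div, div_lt_one hδ2] at hfloor
    exact hfloor.le
  linarith [sub_le_of_subgradient hh'.bddBelow hx hξ (gridPoint δ k)]

lemma abs_sub_le_of_convexCode_eq (hδ : 0 < δ) (hh : IsNormalizedConvex h)
    (hh' : IsNormalizedConvex h') (hcode : convexCode δ h = convexCode δ h')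
    {x : EuclideanSpace ℝ (Fin d)} (hx : x ∈ unitCube d) :
    |h x - h' x| ≤ (d + 2) / 2 * δ ^ 2 :=
  abs_sub_le_iff.2 ⟨sub_le_of_convexCode_eq hδ hh hh' hcode hx,
    sub_le_of_convexCode_eq hδ hh' hh hcode.symm hx⟩

lemma log_card_codeSet (d : ℕ) (δ : ℝ) : Real.log (codeSet d δ).card =
    d * gridSize δ ^ d * Real.log 4 +
      2 ^ d * Real.log (2 * ⌈(1 + 32 * d) / δ ^ 2⌉₊ + 1) := by
  have hcard : (Finset.Icc (-(⌈(1 + 32 * d) / δ ^ 2⌉₊ : ℤ)) ⌈(1 + 32 * d) / δ ^ 2⌉₊).card =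
      2 * ⌈(1 + 32 * d) / δ ^ 2⌉₊ + 1 := by
    rw [Int.card_Icc]
    lia
  have hcard' : (Finset.Icc (-1 : ℤ) 2).card = 4 := rfl
  simp only [codeSet, Finset.card_product, Fintype.card_piFinset, hcard, hcard',
    Finset.prod_const, Finset.card_univ]
  push_cast
  rw [Real.log_mul (by positivity) (by positivity), Real.log_pow, Real.log_pow]
  simp

lemma exists_log_card_codeSet_le (hd : 1 ≤ d) :
    ∃ C : ℝ, 0 < C ∧ ∀ δ : ℝ, 0 < δ → δ ≤ 1 →
      Real.log (codeSet d δ).card ≤ C * (1 / δ) ^ d := by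
  refine ⟨d * 18 ^ d * Real.log 4 + 2 ^ d * (6 + 64 * d), by positivity, fun δ hδ hδ1 => ?_⟩
  have hinv : 1 ≤ 1 / δ := (one_le_div hδ).2 hδ1
  have hgrid : (gridSize δ : ℝ) ≤ 18 * (1 / δ) := by
    have hfloor : (⌊17 / δ⌋₊ : ℝ) ≤ 17 / δ := Nat.floor_le (by positivity)
    rw [gridSize, Nat.cast_add_one]
    linarith [mul_one_div 17 δ]
  have hvalues : Real.log (2 * ⌈(1 + 32 * d) / δ ^ 2⌉₊ + 1) ≤ (6 + 64 * d) * (1 / δ) ^ d := by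
    have hceil : (2 * ⌈(1 + 32 * d) / δ ^ 2⌉₊ + 1 : ℝ) ≤ (5 + 64 * d) * (1 / δ) ^ 2 := by
      have hlt : (⌈(1 + 32 * d) / δ ^ 2⌉₊ : ℝ) < (1 + 32 * d) / δ ^ 2 + 1 :=
        Nat.ceil_lt_add_one (by positivity)
      have hquot : (1 + 32 * d) / δ ^ 2 = (1 + 32 * d) * (1 / δ) ^ 2 := by
        rw [div_eq_mul_one_div, one_div_pow]
      linarith [one_le_pow₀ hinv (n := 2)]
    have hbase := Real.log_le_sub_one_of_pos (by positivity : (0 : ℝ) < 5 + 64 * d)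
    have hmesh := Real.log_le_sub_one_of_pos (by positivity : 0 < 1 / δ)
    calc Real.log (2 * ⌈(1 + 32 * d) / δ ^ 2⌉₊ + 1)
        ≤ Real.log ((5 + 64 * d) * (1 / δ) ^ 2) := Real.log_le_log (by positivity) hceil
      _ = Real.log (5 + 64 * d) + 2 * Real.log (1 / δ) := by
        rw [Real.log_mul (by positivity) (by positivity), Real.log_pow]
        norm_num
      _ ≤ (6 + 64 * d) * (1 / δ) := by nlinarith
      _ ≤ (6 + 64 * d) * (1 / δ) ^ d := by
        gcongr
        exact le_self_pow₀ hinv (by lia)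
  rw [log_card_codeSet, add_mul]
  calc d * gridSize δ ^ d * Real.log 4 + 2 ^ d * Real.log (2 * ⌈(1 + 32 * d) / δ ^ 2⌉₊ + 1)
      ≤ d * (18 * (1 / δ)) ^ d * Real.log 4 + 2 ^ d * ((6 + 64 * d) * (1 / δ) ^ d) := by gcongr
    _ = d * 18 ^ d * Real.log 4 * (1 / δ) ^ d + 2 ^ d * (6 + 64 * d) * (1 / δ) ^ d := by ring

end Code

section PointwiseBound

lemma abs_le_three_mul_of_convexOn {E : Type*} [AddCommGroup E] [Module ℝ E] {U : Set E}
    {f : E → ℝ} (hf : ConvexOn ℝ U f) {x u : E} (hadd : x + u ∈ U) (hsub : x - u ∈ U)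
    (hadd₂ : x + (2 : ℝ) • u ∈ U) {T : ℝ} (haddT : |f (x + u)| ≤ T) (hsubT : |f (x - u)| ≤ T)
    (hadd₂T : |f (x + (2 : ℝ) • u)| ≤ T) : |f x| ≤ 3 * T := by
  have hhalf : (0 : ℝ) ≤ 1 / 2 := by norm_num
  have hx : (1 / 2 : ℝ) • (x + u) + (1 / 2 : ℝ) • (x - u) = x := by module
  have hxu : (1 / 2 : ℝ) • x + (1 / 2 : ℝ) • (x + (2 : ℝ) • u) = x + u := by module
  have hxU : x ∈ U := hx ▸ hf.1 hadd hsub hhalf hhalf (add_halves 1)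
  have hupper := hf.2 hadd hsub hhalf hhalf (add_halves 1)
  have hlower := hf.2 hxU hadd₂ hhalf hhalf (add_halves 1)
  rw [hx] at hupper
  rw [hxu] at hlower
  simp only [smul_eq_mul] at hupper hlower
  rw [abs_le] at *
  constructor <;> linarith

variable {E : Type*} [NormedAddCommGroup E] [NormedSpace ℝ E] [FiniteDimensional ℝ E]
  [MeasurableSpace E] [BorelSpace E] {μ : Measure E} [μ.IsAddHaarMeasure]

lemma exists_add_sub_add_two_smul_notMem {S W : Set E} (hSW : 3 * μ S < μ W) (x : E) :
    ∃ u ∈ W, x + u ∉ S ∧ x - u ∉ S ∧ x + (2 : ℝ) • u ∉ S := by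
  by_contra! hcover
  have hsub : μ ((fun u => x - u) ⁻¹' S) = μ S :=
    (μ.measurePreserving_sub_left x).measure_preimage_equiv (f := MeasurableEquiv.subLeft x) S
  have htwo : μ ((fun u => x + (2 : ℝ) • u) ⁻¹' S) ≤ μ S := by
    have hscale := Measure.addHaar_preimage_smul μ (two_ne_zero (α := ℝ)) ((x + ·) ⁻¹' S)
    rw [Set.preimage_preimage, measure_preimage_add] at hscale
    rw [hscale]
    refine mul_le_of_le_one_left' (ENNReal.ofReal_le_one.2 ?_)
    rw [abs_of_pos (by positivity)]
    exact inv_le_one_of_one_le₀ (one_le_pow₀ one_le_two)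
  have hW : W ⊆ (x + ·) ⁻¹' S ∪ (fun u => x - u) ⁻¹' S ∪ (fun u => x + (2 : ℝ) • u) ⁻¹' S := by
    intro u hu
    by_cases hadd : x + u ∈ S
    · exact Or.inl (Or.inl hadd)
    by_cases hsub : x - u ∈ S
    · exact Or.inl (Or.inr hsub)
    exact Or.inr (hcover u hu hadd hsub)
  refine hSW.not_ge ?_
  calc μ W ≤ μ S + μ S + μ S := (measure_mono hW).trans <| (measure_union_le _ _).trans <|
        add_le_add ((measure_union_le _ _).trans_eq (by rw [measure_preimage_add, hsub])) htwo
    _ = 3 * μ S := by ring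

lemma abs_le_three_mul_of_eLpNorm_lt {p : ℝ≥0∞} (hp0 : p ≠ 0) (hp : p ≠ ∞) {U : Set E} {f : E → ℝ}
    (hU : IsOpen U) (hf : ConvexOn ℝ U f) {x : E} {W : Set E}
    (hW : ∀ u ∈ W, x + u ∈ U ∧ x - u ∈ U ∧ x + (2 : ℝ) • u ∈ U) {T : ℝ}
    (hT : 3 * eLpNorm f p (μ.restrict U) ^ p.toReal < ENNReal.ofReal T ^ p.toReal * μ W) :
    |f x| ≤ 3 * T := by
  set S : Set E := {y | ENNReal.ofReal T ≤ ‖f y‖ₑ}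
  have hmeas : AEStronglyMeasurable f (μ.restrict U) :=
    (hf.continuousOn hU).aestronglyMeasurable hU.measurableSet
  have hS : 3 * μ (S ∩ U) < μ W := by
    have hmarkov := mul_meas_ge_le_pow_eLpNorm' (μ.restrict U) hp0 hp hmeas (ENNReal.ofReal T)
    refine lt_of_mul_lt_mul_left' (a := ENNReal.ofReal T ^ p.toReal) (lt_of_le_of_lt ?_ hT)
    rw [mul_left_comm]
    gcongr
    exact (mul_le_mul_right (Measure.le_restrict_apply U S) _).trans hmarkov
  obtain ⟨u, hu, hadd, hsub, hadd₂⟩ := exists_add_sub_add_two_smul_notMem hS x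
  have hsmall : ∀ y ∈ U, y ∉ S ∩ U → |f y| ≤ T := fun y hy hyS => by
    have hlt : ‖f y‖ₑ < ENNReal.ofReal T := not_le.1 fun h => hyS ⟨h, hy⟩
    rw [Real.enorm_eq_ofReal_abs] at hlt
    simpa using ((ENNReal.lt_ofReal_iff_toReal_lt ENNReal.ofReal_ne_top).1 hlt).le
  obtain ⟨haddU, hsubU, hadd₂U⟩ := hW u hu
  exact abs_le_three_mul_of_convexOn hf haddU hsubU hadd₂U (hsmall _ haddU hadd)
    (hsmall _ hsubU hsub) (hsmall _ hadd₂U hadd₂)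

end PointwiseBound

/-- A bound for the values, near the box with side lengths `l`, of a convex function whose `L_p`
norm on the concentric box with sides `3 * l` is at most `B`. -/
noncomputable def boxBound {d : ℕ} (p B : ℝ) (l : Fin d → ℝ) : ℝ :=
  3 * (B * (4 ^ (d + 1) / ∏ i, l i) ^ (1 / p))

/-- The restriction of `f` to a neighbourhood of the box `[s, s + l]`, carried over to the unit cube
and divided by `boxBound p B l`. -/
noncomputable def boxNormalize {d : ℕ} (p B : ℝ) (s l : Fin d → ℝ) (f : (Fin d → ℝ) → ℝ)
    (t : EuclideanSpace ℝ (Fin d)) : ℝ :=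
  f (s + l * WithLp.ofLp t) / boxBound p B l

section Box

variable {d : ℕ} {p B : ℝ} {s l : Fin d → ℝ} {f : (Fin d → ℝ) → ℝ}

lemma boxBound_pos (hB : 0 < B) (hl : ∀ i, 0 < l i) : 0 < boxBound p B l := by
  have hvol : 0 < ∏ i, l i := Finset.prod_pos fun i _ => hl i
  unfold boxBound
  positivity

lemma three_mul_ofReal_rpow_lt (hp : 0 < p) (hB : 0 < B) {V : ℝ} (hV : 0 < V) (d : ℕ) :
    3 * ENNReal.ofReal B ^ p <
      ENNReal.ofReal (B * (4 ^ (d + 1) / V) ^ (1 / p)) ^ p * ENNReal.ofReal (V / 4 ^ d) := by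
  have hBp : 0 < B ^ p := by positivity
  have hfour : (B * (4 ^ (d + 1) / V) ^ (1 / p)) ^ p * (V / 4 ^ d) = 4 * B ^ p := by
    rw [Real.mul_rpow hB.le (by positivity), ← Real.rpow_mul (by positivity),
      one_div_mul_cancel hp.ne', Real.rpow_one]
    field_simp
    ring
  rw [ENNReal.ofReal_rpow_of_pos hB, ENNReal.ofReal_rpow_of_pos (by positivity),
    ← ENNReal.ofReal_mul (by positivity), hfour, ← ENNReal.ofReal_ofNat 3,
    ← ENNReal.ofReal_mul (by positivity), ENNReal.ofReal_lt_ofReal_iff (by positivity)]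
  linarith

lemma abs_le_boxBound (hp : 0 < p) (hB : 0 < B) (hl : ∀ i, 0 < l i)
    (hf : ConvexOn ℝ (Set.Icc (s - l) (s + (2 : ℝ) • l)) f)
    (hfB : eLpNorm f (ENNReal.ofReal p) (volume.restrict (Set.Icc (s - l) (s + (2 : ℝ) • l))) ≤
      ENNReal.ofReal B)
    {x : Fin d → ℝ} (hx : ∀ i, x i ∈ Set.Icc (s i - l i / 2) (s i + l i * (3 / 2))) :
    |f x| ≤ boxBound p B l := by
  set U : Set (Fin d → ℝ) := Set.univ.pi fun i => Set.Ioo ((s - l) i) ((s + (2 : ℝ) • l) i)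
  set W : Set (Fin d → ℝ) := Set.univ.pi fun i => Set.Ioo 0 (l i / 4)
  have hUo : IsOpen U := isOpen_set_pi Set.finite_univ fun i _ => isOpen_Ioo
  have hUI : U ⊆ Set.Icc (s - l) (s + (2 : ℝ) • l) := fun y hy =>
    ⟨fun i => (hy i trivial).1.le, fun i => (hy i trivial).2.le⟩
  have hUc : Convex ℝ U := convex_pi fun i _ => convex_Ioo _ _
  have hWU : ∀ u ∈ W, x + u ∈ U ∧ x - u ∈ U ∧ x + (2 : ℝ) • u ∈ U := fun u hu => by
    refine ⟨fun i _ => ?_, fun i _ => ?_, fun i _ => ?_⟩ <;>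
    · obtain ⟨hlow, hhigh⟩ := hx i
      obtain ⟨hpos, hlt⟩ := hu i trivial
      simp only [Pi.add_apply, Pi.sub_apply, Pi.smul_apply, smul_eq_mul]
      constructor <;> linarith
  have hvol : 0 < ∏ i, l i := Finset.prod_pos fun i _ => hl i
  have hWvol : volume W = ENNReal.ofReal ((∏ i, l i) / 4 ^ d) := by
    rw [volume_pi_pi]
    simp only [Real.volume_Ioo, sub_zero]
    rw [← ENNReal.ofReal_prod_of_nonneg fun i _ => (div_pos (hl i) four_pos).le,
      Finset.prod_div_distrib]
    simp
  refine abs_le_three_mul_of_eLpNorm_lt (ENNReal.ofReal_pos.2 hp).ne' ENNReal.ofReal_ne_top hUo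
    (hf.subset hUI hUc) hWU (μ := volume) ?_
  rw [ENNReal.toReal_ofReal hp.le, hWvol]
  refine lt_of_le_of_lt ?_ (three_mul_ofReal_rpow_lt hp hB hvol d)
  gcongr
  exact (eLpNorm_mono_measure f (Measure.restrict_mono hUI le_rfl)).trans hfB

lemma add_mul_mem_of_mem_thickening (hl : ∀ i, 0 < l i) {t : EuclideanSpace ℝ (Fin d)}
    (ht : t ∈ Metric.thickening (1 / 2) (unitCube d)) (i : Fin d) :
    (s + l * WithLp.ofLp t) i ∈ Set.Icc (s i - l i / 2) (s i + l i * (3 / 2)) := by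
  obtain ⟨y, hy, hty⟩ := Metric.mem_thickening_iff.1 ht
  rw [dist_eq_norm] at hty
  obtain ⟨hlow, hhigh⟩ := abs_le.1 ((PiLp.norm_apply_le (t - y) i).trans hty.le)
  rw [PiLp.sub_apply] at hlow hhigh
  obtain ⟨hy0, hy1⟩ := hy i
  have hli := hl i
  simp only [Pi.add_apply, Pi.mul_apply]
  constructor <;> nlinarith

lemma isNormalizedConvex_boxNormalize (hp : 0 < p) (hB : 0 < B) (hl : ∀ i, 0 < l i)
    (hf : ConvexOn ℝ (Set.Icc (s - l) (s + (2 : ℝ) • l)) f)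
    (hfB : eLpNorm f (ENNReal.ofReal p) (volume.restrict (Set.Icc (s - l) (s + (2 : ℝ) • l))) ≤
      ENNReal.ofReal B) :
    IsNormalizedConvex (boxNormalize p B s l f) := by
  have hpos : 0 < boxBound p B l := boxBound_pos hB hl
  constructor
  · set φ : EuclideanSpace ℝ (Fin d) →ᵃ[ℝ] (Fin d → ℝ) :=
      ((LinearMap.mulLeft ℝ l).comp (WithLp.linearEquiv 2 ℝ (Fin d → ℝ)).toLinearMap).toAffineMap +
        AffineMap.const ℝ _ s
    have hφ : ∀ t, φ t = s + l * WithLp.ofLp t := fun t => add_comm _ _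
    have hmaps : Metric.thickening (1 / 2) (unitCube d) ⊆
        φ ⁻¹' Set.Icc (s - l) (s + (2 : ℝ) • l) := fun t ht => by
      rw [Set.mem_preimage, hφ]
      refine ⟨fun i => ?_, fun i => ?_⟩ <;>
      · obtain ⟨hlow, hhigh⟩ := add_mul_mem_of_mem_thickening (s := s) hl ht i
        have hli := hl i
        simp only [Pi.sub_apply, Pi.add_apply, Pi.smul_apply, smul_eq_mul] at hlow hhigh ⊢
        linarith
    have hscaled := ((hf.comp_affineMap φ).subset hmaps (convex_unitCube.thickening _)).smul
      (inv_nonneg.2 hpos.le)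
    refine hscaled.congr fun t _ => ?_
    simp only [boxNormalize, Function.comp_apply, hφ, smul_eq_mul, div_eq_inv_mul]
  · intro t ht
    rw [boxNormalize, abs_div, abs_of_pos hpos, div_le_one hpos]
    exact abs_le_boxBound hp hB hl hf hfB (add_mul_mem_of_mem_thickening hl ht)

lemma abs_sub_le_of_convexCode_boxNormalize_eq (hB : 0 < B) (hl : ∀ i, 0 < l i)
    {g : (Fin d → ℝ) → ℝ} (hf : IsNormalizedConvex (boxNormalize p B s l f))
    (hg : IsNormalizedConvex (boxNormalize p B s l g)) {δ : ℝ} (hδ : 0 < δ)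
    (hcode : convexCode δ (boxNormalize p B s l f) = convexCode δ (boxNormalize p B s l g))
    {x : Fin d → ℝ} (hx : x ∈ Set.Icc s (s + l)) :
    |f x - g x| ≤ boxBound p B l * ((d + 2) / 2 * δ ^ 2) := by
  have hpos : 0 < boxBound p B l := boxBound_pos hB hl
  set t : EuclideanSpace ℝ (Fin d) := WithLp.toLp 2 ((x - s) / l)
  have ht : t ∈ unitCube d := fun i =>
    ⟨div_nonneg (sub_nonneg.2 (hx.1 i)) (hl i).le,
      div_le_one_of_le₀ (sub_le_iff_le_add'.2 (hx.2 i)) (hl i).le⟩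
  have hxt : s + l * WithLp.ofLp t = x := by
    ext i
    simp only [t, Pi.add_apply, Pi.mul_apply, Pi.div_apply, Pi.sub_apply,
      mul_div_cancel₀ _ (hl i).ne', add_sub_cancel]
  have hclose := abs_sub_le_of_convexCode_eq hδ hf hg hcode ht
  rwa [boxNormalize, boxNormalize, hxt, ← sub_div, abs_div, abs_of_pos hpos,
    div_le_iff₀' hpos] at hclose

end Box

section LpBound

variable {α F : Type*} [MeasurableSpace α] {μ : Measure α} {p : ℝ}

lemma eLpNorm_le_iff_lintegral_rpow_le [NormedAddCommGroup F] (hp : 0 < p) {f : α → F} {r : ℝ≥0∞} :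
    eLpNorm f (ENNReal.ofReal p) μ ≤ r ↔ ∫⁻ x, ‖f x‖ₑ ^ p ∂μ ≤ r ^ p := by
  rw [eLpNorm_eq_lintegral_rpow_enorm_toReal (ENNReal.ofReal_pos.2 hp).ne' ENNReal.ofReal_ne_top,
    ENNReal.toReal_ofReal hp.le, one_div, ENNReal.rpow_inv_le_iff hp]

lemma eLpNorm_restrict_le_of_subset_iUnion [NormedAddCommGroup F] (hp : 0 < p) {J : Set α}
    {ι : Type*} [Fintype ι] {A : ι → Set α} (hJ : J ⊆ ⋃ j, A j) {f : α → F} {r : ι → ℝ≥0∞}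
    (hr : ∀ j, ∀ x ∈ A j, ‖f x‖ₑ ≤ r j) {R : ℝ≥0∞} (hR : ∑ j, r j ^ p * μ (A j) ≤ R ^ p) :
    eLpNorm f (ENNReal.ofReal p) (μ.restrict J) ≤ R := by
  rw [eLpNorm_le_iff_lintegral_rpow_le hp]
  calc ∫⁻ x in J, ‖f x‖ₑ ^ p ∂μ
      ≤ ∫⁻ x in ⋃ j, A j, ‖f x‖ₑ ^ p ∂μ := lintegral_mono_set hJ
    _ ≤ ∑ j, ∫⁻ x in A j, ‖f x‖ₑ ^ p ∂μ := by
        simpa only [tsum_fintype] using lintegral_iUnion_le A fun x => ‖f x‖ₑ ^ p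
    _ ≤ ∑ j, ∫⁻ _ in A j, r j ^ p ∂μ := by
        gcongr ∑ j, ?_ with j
        exact setLIntegral_mono measurable_const fun x hx =>
          ENNReal.rpow_le_rpow (hr j x hx) hp.le
    _ ≤ R ^ p := by simpa only [setLIntegral_const] using hR

end LpBound

section Entropy

variable {d : ℕ} {p B ε : ℝ} {F : Set ((Fin d → ℝ) → ℝ)} {I J : Set (Fin d → ℝ)}

lemma eLpNorm_le_of_mem_convexClass (hp : 0 < p) (hB : 0 ≤ B) {f : (Fin d → ℝ) → ℝ}
    (hf : f ∈ convexClass p I B) :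
    eLpNorm f (ENNReal.ofReal p) (volume.restrict I) ≤ ENNReal.ofReal B := by
  rw [eLpNorm_le_iff_lintegral_rpow_le hp, ENNReal.ofReal_rpow_of_nonneg hB hp.le]
  simpa only [Real.enorm_eq_ofReal_abs, ENNReal.ofReal_rpow_of_nonneg (abs_nonneg _) hp.le]
    using hf.2

lemma eLpNorm_restrict_le_of_mem_convexClass (hp : 0 < p) (hB : 0 ≤ B) (hJI : J ⊆ I)
    {f : (Fin d → ℝ) → ℝ} (hf : f ∈ convexClass p I B) :
    eLpNorm f (ENNReal.ofReal p) (volume.restrict J) ≤ ENNReal.ofReal B :=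
  (eLpNorm_mono_measure f (Measure.restrict_mono hJI le_rfl)).trans
    (eLpNorm_le_of_mem_convexClass hp hB hf)

lemma memLp_of_mem_convexClass (hp : 0 < p) (hB : 0 ≤ B) (hJ : MeasurableSet J)
    (hJI : J ⊆ interior I) {f : (Fin d → ℝ) → ℝ} (hf : f ∈ convexClass p I B) :
    MemLp f (ENNReal.ofReal p) (volume.restrict J) :=
  ⟨(hf.1.continuousOn_interior.mono hJI).aestronglyMeasurable hJ,
    (eLpNorm_restrict_le_of_mem_convexClass hp hB (hJI.trans interior_subset) hf).trans_lt
      ENNReal.ofReal_lt_top⟩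

lemma lpMetricEntropy_le_of_encard_le {C : Set ((Fin d → ℝ) → ℝ)} (hC : IsLpCover p J F ε C)
    {n : ℕ} (hn : C.encard ≤ n) : lpMetricEntropy F ε p J ≤ (Real.log n : EReal) := by
  have hcover : lpCoveringNumber F ε p J ≤ n := (iInf₂_le C hC).trans hn
  rcases Nat.eq_zero_or_pos n with rfl | hpos
  · simp [lpMetricEntropy, nonpos_iff_eq_zero.1 hcover]
  · rw [← ENNReal.log_ofReal_of_pos (Nat.cast_pos.2 hpos), ENNReal.ofReal_natCast]
    exact ENNReal.log_le_log (by exact_mod_cast hcover)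

lemma lpMetricEntropy_le_of_code (hF : ∀ f ∈ F, MemLp f (ENNReal.ofReal p) (volume.restrict J))
    {γ : Type*} {T : Finset γ} {code : ((Fin d → ℝ) → ℝ) → γ} (hT : ∀ f ∈ F, code f ∈ T)
    (hcode : ∀ f ∈ F, ∀ g ∈ F, code f = code g →
      eLpNorm (f - g) (ENNReal.ofReal p) (volume.restrict J) ≤ ENNReal.ofReal ε) :
    lpMetricEntropy F ε p J ≤ (Real.log T.card : EReal) := by
  obtain ⟨C, hCF, hinj, himage⟩ := (Set.surjOn_image code F).exists_subset_injOn_image_eq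
  refine lpMetricEntropy_le_of_encard_le (C := C) ⟨fun g hg => hF g (hCF hg), fun f hf => ?_⟩ ?_
  · obtain ⟨g, hg, hgf⟩ := himage.ge (Set.mem_image_of_mem code hf)
    exact ⟨g, hg, hcode f hf g (hCF hg) hgf.symm⟩
  · rw [← hinj.encard_image, himage, ← Set.encard_coe_eq_coe_finsetCard]
    exact Set.encard_le_encard (Set.image_subset_iff.2 hT)

lemma lpMetricEntropy_convexClass_nonpos (hp : 0 < p) (hB : 0 ≤ B) (hBε : B ≤ ε) (hJI : J ⊆ I) :
    lpMetricEntropy (convexClass p I B) ε p J ≤ 0 := by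
  have hcover : IsLpCover p J (convexClass p I B) ε {0} := by
    refine ⟨?_, fun f hf => ⟨0, rfl, ?_⟩⟩
    · rintro _ rfl
      exact MemLp.zero
    · rw [sub_zero]
      exact (eLpNorm_restrict_le_of_mem_convexClass hp hB hJI hf).trans
        (ENNReal.ofReal_le_ofReal hBε)
  simpa using lpMetricEntropy_le_of_encard_le hcover (n := 1) (by simp)

lemma sum_boxBound_rpow_mul_volume_le (hp : 0 < p) (hB : 0 < B) {ι : Type*} [Fintype ι]
    {s l : ι → Fin d → ℝ} (hl : ∀ j i, 0 < l j i) {ρ : ℝ} (hρ : 0 ≤ ρ)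
    (hρε : 3 * B * ρ * (Fintype.card ι * 4 ^ (d + 1)) ^ (1 / p) ≤ ε) :
    ∑ j, ENNReal.ofReal (boxBound p B (l j) * ρ) ^ p * volume (Set.Icc (s j) (s j + l j)) ≤
      ENNReal.ofReal ε ^ p := by
  have hvol : ∀ j, 0 < ∏ i, l j i := fun j => Finset.prod_pos fun i _ => hl j i
  have hpow : ∀ x : ℝ, 0 ≤ x → (3 * B * ρ * x ^ (1 / p)) ^ p = (3 * B * ρ) ^ p * x :=
    fun x hx => by
      rw [Real.mul_rpow (by positivity) (by positivity), ← Real.rpow_mul hx,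
        one_div_mul_cancel hp.ne', Real.rpow_one]
  have hterm : ∀ j, ENNReal.ofReal (boxBound p B (l j) * ρ) ^ p *
      volume (Set.Icc (s j) (s j + l j)) = ENNReal.ofReal ((3 * B * ρ) ^ p * 4 ^ (d + 1)) :=
    fun j => by
      have hbound := boxBound_pos (p := p) hB (hl j)
      have hV := hvol j
      have hconst : boxBound p B (l j) * ρ = 3 * B * ρ * (4 ^ (d + 1) / ∏ i, l j i) ^ (1 / p) := by
        unfold boxBound
        ring
      rw [ENNReal.ofReal_rpow_of_nonneg (by positivity) hp.le, Real.volume_Icc_pi,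
        ← ENNReal.ofReal_prod_of_nonneg fun i _ => by simpa using (hl j i).le,
        ← ENNReal.ofReal_mul (by positivity), hconst, hpow _ (by positivity)]
      simp only [Pi.add_apply, add_sub_cancel_left, mul_assoc, div_mul_cancel₀ _ hV.ne']
  rw [Finset.sum_congr rfl fun j _ => hterm j, Finset.sum_const, Finset.card_univ,
    nsmul_eq_mul, ← ENNReal.ofReal_natCast, ← ENNReal.ofReal_mul (by positivity), mul_left_comm,
    ← hpow _ (by positivity), ← ENNReal.ofReal_rpow_of_nonneg (by positivity) hp.le]
  gcongr

lemma lpMetricEntropy_convexClass_le_of_boxes (hp : 0 < p) (hB : 0 < B) (hJ : MeasurableSet J)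
    (hJI : J ⊆ interior I) {ι : Type*} [Fintype ι] {s l : ι → Fin d → ℝ} (hl : ∀ j i, 0 < l j i)
    (hI : ∀ j, Set.Icc (s j - l j) (s j + (2 : ℝ) • l j) ⊆ I)
    (hcover : J ⊆ ⋃ j, Set.Icc (s j) (s j + l j)) {δ : ℝ} (hδ : 0 < δ) (hδ1 : δ ≤ 1)
    (hδε : 3 * B * ((d + 2) / 2 * δ ^ 2) * (Fintype.card ι * 4 ^ (d + 1)) ^ (1 / p) ≤ ε) :
    lpMetricEntropy (convexClass p I B) ε p J ≤
      ((Fintype.card ι * Real.log (codeSet d δ).card : ℝ) : EReal) := by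
  classical
  have hnorm : ∀ f ∈ convexClass p I B, ∀ j,
      IsNormalizedConvex (boxNormalize p B (s j) (l j) f) := fun f hf j =>
    isNormalizedConvex_boxNormalize hp hB (hl j) (hf.1.subset (hI j) (convex_Icc _ _))
      (eLpNorm_restrict_le_of_mem_convexClass hp hB.le (hI j) hf)
  have hentropy := lpMetricEntropy_le_of_code (ε := ε)
    (fun f hf => memLp_of_mem_convexClass hp hB.le hJ hJI hf)
    (T := Fintype.piFinset fun _ : ι => codeSet d δ)
    (code := fun f j => convexCode δ (boxNormalize p B (s j) (l j) f))
    (fun f hf => Fintype.mem_piFinset.2 fun j => convexCode_mem_codeSet hδ hδ1 (hnorm f hf j))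
    fun f hf g hg hfg => by
      refine eLpNorm_restrict_le_of_subset_iUnion hp hcover
        (r := fun j => ENNReal.ofReal (boxBound p B (l j) * ((d + 2) / 2 * δ ^ 2)))
        (fun j x hx => ?_) (sum_boxBound_rpow_mul_volume_le hp hB hl (by positivity) hδε)
      rw [Real.enorm_eq_ofReal_abs]
      exact ENNReal.ofReal_le_ofReal (abs_sub_le_of_convexCode_boxNormalize_eq hB (hl j)
        (hnorm f hf j) (hnorm g hg j) hδ (congrFun hfg j) hx)
  simpa [Fintype.card_piFinset] using hentropy

end Entropy

/-- The common length of the two level-`k` intervals of the dyadic decomposition of `(a, b)` into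
intervals whose distance to the boundary equals their length. -/
noncomputable def dyadicLength (a b : ℝ) (k : ℕ) : ℝ := (b - a) * (1 / 2) ^ (k + 2)

/-- The left end point of the level-`k` interval near `b`, if `right`, and near `a` otherwise, of
the dyadic decomposition of `(a, b)`. -/
noncomputable def dyadicStart (a b : ℝ) (k : ℕ) (right : Bool) : ℝ :=
  if right then b - 2 * dyadicLength a b k else a + dyadicLength a b k

section Dyadic

variable {a b : ℝ}

lemma dyadicLength_pos (hab : a < b) (k : ℕ) : 0 < dyadicLength a b k :=
  mul_pos (sub_pos.2 hab) (by positivity)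

lemma four_mul_dyadicLength_le (hab : a < b) (k : ℕ) : 4 * dyadicLength a b k ≤ b - a := by
  have hpow : (1 / 2 : ℝ) ^ k ≤ 1 := pow_le_one₀ (by norm_num) (by norm_num)
  calc 4 * dyadicLength a b k = (b - a) * (1 / 2) ^ k := by
        rw [dyadicLength, pow_add]
        ring
    _ ≤ b - a := mul_le_of_le_one_right (sub_pos.2 hab).le hpow

lemma le_dyadicStart_sub (hab : a < b) (k : ℕ) (right : Bool) :
    a ≤ dyadicStart a b k right - dyadicLength a b k := by
  have hlen := four_mul_dyadicLength_le hab k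
  have hpos := dyadicLength_pos hab k
  cases right <;> simp only [dyadicStart, if_true, Bool.false_eq_true, if_false] <;> linarith

lemma dyadicStart_add_le (hab : a < b) (k : ℕ) (right : Bool) :
    dyadicStart a b k right + 2 * dyadicLength a b k ≤ b := by
  have hlen := four_mul_dyadicLength_le hab k
  have hpos := dyadicLength_pos hab k
  cases right <;> simp only [dyadicStart, if_true, Bool.false_eq_true, if_false] <;> linarith

lemma exists_dyadicLength_le {t : ℝ} {m : ℕ} (hab : a < b) (hm : (b - a) * (1 / 2) ^ m ≤ t)
    (ht : 2 * t ≤ b - a) : ∃ k < m, dyadicLength a b k ≤ t ∧ t ≤ 2 * dyadicLength a b k := by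
  have hba : 0 < b - a := sub_pos.2 hab
  have ht0 : 0 < t := lt_of_lt_of_le (by positivity) hm
  obtain ⟨k, hlow, hhigh⟩ := exists_nat_pow_near_of_lt_one (x := 2 * t / (b - a))
    (y := (1 / 2 : ℝ)) (by positivity) ((div_le_one hba).2 ht) (by norm_num) (by norm_num)
  rw [lt_div_iff₀' hba] at hlow
  rw [div_le_iff₀' hba] at hhigh
  have hquarter : (b - a) * (1 / 2) ^ k = 4 * dyadicLength a b k := by
    rw [dyadicLength, pow_add]
    ring
  have hhalf : (b - a) * (1 / 2) ^ (k + 1) = 2 * dyadicLength a b k := by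
    rw [dyadicLength, pow_add, pow_add]
    ring
  refine ⟨k, ?_, by linarith, by linarith⟩
  by_contra! hmk
  have hpow : (b - a) * (1 / 2) ^ k ≤ (b - a) * (1 / 2) ^ m :=
    mul_le_mul_of_nonneg_left (pow_le_pow_of_le_one (by norm_num) (by norm_num) hmk) hba.le
  linarith

lemma exists_mem_Icc_dyadicStart {x : ℝ} {m : ℕ} (hab : a < b)
    (ha : (b - a) * (1 / 2) ^ m ≤ x - a) (hb : (b - a) * (1 / 2) ^ m ≤ b - x) :
    ∃ q : Fin m × Bool, x ∈ Set.Icc (dyadicStart a b q.1 q.2)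
      (dyadicStart a b q.1 q.2 + dyadicLength a b q.1) := by
  rcases le_total (x - a) (b - x) with hx | hx
  · obtain ⟨k, hk, hlow, hhigh⟩ := exists_dyadicLength_le hab ha (by linarith)
    refine ⟨(⟨k, hk⟩, false), ?_⟩
    simp only [dyadicStart, Bool.false_eq_true, if_false]
    constructor <;> linarith
  · obtain ⟨k, hk, hlow, hhigh⟩ := exists_dyadicLength_le hab hb (by linarith)
    refine ⟨(⟨k, hk⟩, true), ?_⟩
    simp only [dyadicStart, if_true]
    constructor <;> linarith

lemma exists_half_pow_le {η : ℝ} (hη : 0 < η) (hη2 : η ≤ 1 / 2) :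
    ∃ m : ℕ, 0 < m ∧ (1 / 2 : ℝ) ^ m ≤ η ∧ (m : ℝ) ≤ 3 * Real.log (1 / η) := by
  have hlog2 : 0 < Real.log 2 := Real.log_pos one_lt_two
  have hlog : Real.log 2 ≤ Real.log (1 / η) :=
    Real.log_le_log two_pos ((le_one_div two_pos hη).2 hη2)
  have hone : 1 ≤ Real.log (1 / η) / Real.log 2 := (one_le_div hlog2).2 hlog
  refine ⟨⌈Real.log (1 / η) / Real.log 2⌉₊, Nat.ceil_pos.2 (by linarith), ?_, ?_⟩
  · have hceil := Nat.le_ceil (Real.log (1 / η) / Real.log 2)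
    rw [div_le_iff₀ hlog2, ← Real.log_pow,
      Real.log_le_log_iff (by positivity) (by positivity)] at hceil
    rw [one_div_pow]
    exact (one_div_le (by positivity) hη).2 hceil
  · calc (⌈Real.log (1 / η) / Real.log 2⌉₊ : ℝ) ≤ 2 * (Real.log (1 / η) / Real.log 2) := by
          linarith [Nat.ceil_lt_add_one (zero_le_one.trans hone)]
      _ ≤ 3 * Real.log (1 / η) := by
          rw [← mul_div_assoc, div_le_iff₀ hlog2]
          nlinarith [Real.log_two_gt_d9]

end Dyadic

section RelDist

variable {d : ℕ} {a b α β : Fin d → ℝ}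

lemma relDist_le (i : Fin d) :
    relDist a b α β ≤ min ((α i - a i) / (b i - a i)) ((b i - β i) / (b i - a i)) :=
  ciInf_le (Set.finite_range _).bddBelow i

lemma relDist_mul_le_sub_left {i : Fin d} (hab : a i < b i) :
    (b i - a i) * relDist a b α β ≤ α i - a i :=
  (le_div_iff₀' (sub_pos.2 hab)).1 ((relDist_le i).trans (min_le_left _ _))

lemma relDist_mul_le_sub_right {i : Fin d} (hab : a i < b i) :
    (b i - a i) * relDist a b α β ≤ b i - β i :=
  (le_div_iff₀' (sub_pos.2 hab)).1 ((relDist_le i).trans (min_le_right _ _))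

lemma relDist_pos [NeZero d] (hab : ∀ i, a i < b i) (hα : ∀ i, a i < α i) (hβ : ∀ i, β i < b i) :
    0 < relDist a b α β := by
  obtain ⟨i, hi⟩ := exists_eq_ciInf_of_finite
    (f := fun i => min ((α i - a i) / (b i - a i)) ((b i - β i) / (b i - a i)))
  rw [relDist, ← hi]
  have hba := sub_pos.2 (hab i)
  exact lt_min (div_pos (sub_pos.2 (hα i)) hba) (div_pos (sub_pos.2 (hβ i)) hba)

lemma relDist_le_half [NeZero d] (hab : ∀ i, a i < b i) (hαβ : ∀ i, α i ≤ β i) :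
    relDist a b α β ≤ 1 / 2 := by
  refine le_of_mul_le_mul_left ?_ (sub_pos.2 (hab 0))
  rw [mul_one_div, le_div_iff₀ two_pos]
  linarith [relDist_mul_le_sub_left (α := α) (β := β) (hab 0),
    relDist_mul_le_sub_right (α := α) (β := β) (hab 0), hαβ 0]

lemma Icc_subset_iUnion_dyadic (hab : ∀ i, a i < b i) {m : ℕ}
    (hm : (1 / 2 : ℝ) ^ m ≤ relDist a b α β) :
    Set.Icc α β ⊆ ⋃ j : Fin d → Fin m × Bool,
      Set.Icc (fun i => dyadicStart (a i) (b i) (j i).1 (j i).2)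
        ((fun i => dyadicStart (a i) (b i) (j i).1 (j i).2) +
          fun i => dyadicLength (a i) (b i) (j i).1) := by
  intro x hx
  have hscale : ∀ i, (b i - a i) * (1 / 2) ^ m ≤ (b i - a i) * relDist a b α β := fun i =>
    mul_le_mul_of_nonneg_left hm (sub_pos.2 (hab i)).le
  choose j hj using fun i => exists_mem_Icc_dyadicStart (x := x i) (hab i)
    ((hscale i).trans <| (relDist_mul_le_sub_left (hab i)).trans (sub_le_sub_right (hx.1 i) _))
    ((hscale i).trans <| (relDist_mul_le_sub_right (hab i)).trans (sub_le_sub_left (hx.2 i) _))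
  exact Set.mem_iUnion.2 ⟨j, fun i => (hj i).1, fun i => (hj i).2⟩

end RelDist

section Main

variable {d : ℕ}

lemma Icc_subset_interior_Icc {ι : Type*} [Finite ι] {a b α β : ι → ℝ} (hα : ∀ i, a i < α i)
    (hβ : ∀ i, β i < b i) : Set.Icc α β ⊆ interior (Set.Icc a b) := by
  rw [← Set.pi_univ_Icc a b, interior_pi_set Set.finite_univ]
  intro x hx i _
  exact interior_Icc.ge ⟨(hα i).trans_le (hx.1 i), (hx.2 i).trans_lt (hβ i)⟩

lemma one_div_sqrt_pow {x : ℝ} (hx : 0 ≤ x) (n : ℕ) : (1 / √x) ^ n = x ^ (-(n : ℝ) / 2) := by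
  rw [one_div, Real.sqrt_eq_rpow, ← Real.rpow_neg hx, ← Real.rpow_natCast, ← Real.rpow_mul hx]
  congr 1
  ring

lemma mul_div_mul_rpow_rpow {n K r : ℝ} (hn : 0 < n) (hK : 0 ≤ K) (hr : 0 ≤ r) (p q : ℝ) :
    n * (r / (K * n ^ (1 / p))) ^ (-q / 2) =
      K ^ (q / 2) * r ^ (-q / 2) * n ^ (1 + q / (2 * p)) := by
  have hexp : 1 / p * (q / 2) = q / (2 * p) := by rw [one_div_mul_eq_div, div_div]
  rw [Real.div_rpow hr (by positivity), Real.mul_rpow hK (by positivity), neg_div,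
    Real.rpow_neg hK, Real.rpow_neg (by positivity : 0 ≤ n ^ (1 / p)), ← Real.rpow_mul hn.le, hexp,
    Real.rpow_add hn, Real.rpow_one]
  field_simp

lemma exists_lpMetricEntropy_convexClass_le_of_boxes (hd : 1 ≤ d) {p : ℝ} (hp : 0 < p) :
    ∃ C : ℝ, 0 < C ∧ ∀ {I J : Set (Fin d → ℝ)}, MeasurableSet J → J ⊆ interior I →
      ∀ {ι : Type} [Fintype ι] [Nonempty ι] {s l : ι → Fin d → ℝ}, (∀ j i, 0 < l j i) →
      (∀ j, Set.Icc (s j - l j) (s j + (2 : ℝ) • l j) ⊆ I) →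
      J ⊆ ⋃ j, Set.Icc (s j) (s j + l j) → ∀ {B ε : ℝ}, 0 < B → 0 < ε →
        lpMetricEntropy (convexClass p I B) ε p J ≤
          ((C * (ε / B) ^ (-(d : ℝ) / 2) *
            (Fintype.card ι : ℝ) ^ (1 + (d : ℝ) / (2 * p)) : ℝ) : EReal) := by
  obtain ⟨C, hC, hcard⟩ := exists_log_card_codeSet_le hd
  set K : ℝ := 3 * ((d + 2) / 2) * (4 ^ (d + 1)) ^ (1 / p)
  have hK : 1 ≤ K := by
    have hpow : (1 : ℝ) ≤ (4 ^ (d + 1)) ^ (1 / p) :=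
      Real.one_le_rpow (one_le_pow₀ (by norm_num)) (by positivity)
    exact one_le_mul_of_one_le_of_one_le (by linarith [d.cast_nonneg (α := ℝ)]) hpow
  refine ⟨C * K ^ ((d : ℝ) / 2), by positivity, ?_⟩
  intro I J hJ hJI ι _ _ s l hl hI hcover B ε hB hε
  rcases le_or_gt B ε with hBε | hεB
  · refine (lpMetricEntropy_convexClass_nonpos hp hB.le hBε (hJI.trans interior_subset)).trans ?_
    exact EReal.coe_nonneg.2 (by positivity)
  set n : ℝ := (Fintype.card ι : ℝ)
  have hn : 1 ≤ n := Nat.one_le_cast.2 Fintype.card_pos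
  set τ : ℝ := ε / B / (K * n ^ (1 / p)) with hτdef
  have hτ : 0 < τ := by positivity
  have hτ1 : τ ≤ 1 := by
    refine div_le_one_of_le₀ (((div_le_one hB).2 hεB.le).trans ?_) (by positivity)
    exact one_le_mul_of_one_le_of_one_le hK (Real.one_le_rpow hn (by positivity))
  have hδ : 0 < √τ := Real.sqrt_pos.2 hτ
  have hδ1 : √τ ≤ 1 := Real.sqrt_le_one.2 hτ1
  have hδε : 3 * B * ((d + 2) / 2 * √τ ^ 2) * (n * 4 ^ (d + 1)) ^ (1 / p) = ε := by
    calc 3 * B * ((d + 2) / 2 * √τ ^ 2) * (n * 4 ^ (d + 1)) ^ (1 / p)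
        = B * (τ * (K * n ^ (1 / p))) := by
          rw [Real.sq_sqrt hτ.le, Real.mul_rpow (by positivity) (by positivity)]
          ring
      _ = ε := by rw [hτdef, div_mul_cancel₀ _ (by positivity), mul_div_cancel₀ _ hB.ne']
  refine (lpMetricEntropy_convexClass_le_of_boxes hp hB hJ hJI hl hI hcover hδ hδ1 hδε.le).trans
    (EReal.coe_le_coe_iff.2 ?_)
  calc n * Real.log (codeSet d √τ).card
      ≤ n * (C * (1 / √τ) ^ d) := by gcongr; exact hcard _ hδ hδ1
    _ = C * (n * τ ^ (-(d : ℝ) / 2)) := by rw [one_div_sqrt_pow hτ.le, mul_left_comm]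
    _ = C * K ^ ((d : ℝ) / 2) * (ε / B) ^ (-(d : ℝ) / 2) * n ^ (1 + (d : ℝ) / (2 * p)) := by
        rw [mul_div_mul_rpow_rpow (by positivity) (by positivity) (by positivity)]
        ring

lemma pow_rpow_le_of_le_three_mul {p m L : ℝ} (hp : 0 < p) (hm : 0 ≤ m) (hmL : m ≤ 3 * L) :
    ((2 * m) ^ d) ^ (1 + (d : ℝ) / (2 * p)) ≤
      6 ^ ((d : ℝ) * (2 * p + d) / (2 * p)) * L ^ ((d : ℝ) * (2 * p + d) / (2 * p)) := by
  have hexp : (d : ℝ) * (1 + d / (2 * p)) = d * (2 * p + d) / (2 * p) := by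
    field_simp
  rw [← Real.rpow_natCast, ← Real.rpow_mul (by positivity), hexp,
    ← Real.mul_rpow (by norm_num) (by linarith)]
  exact Real.rpow_le_rpow (by positivity) (by linarith) (by positivity)

theorem theorem4_general (d : ℕ) (hd : 1 ≤ d) (p : ℝ) (hp : 0 < p) :
    ∃ c : ℝ, 0 < c ∧
      ∀ a b α β : Fin d → ℝ, (∀ i, a i < α i ∧ α i ≤ β i ∧ β i < b i) →
      ∀ B : ℝ, 0 < B → ∀ ε : ℝ, 0 < ε →
        lpMetricEntropy (convexClass p (Set.Icc a b) B) ε p (Set.Icc α β) ≤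
          ((c * (ε / B) ^ (-(d : ℝ) / 2) *
            Real.log (1 / relDist a b α β) ^ ((d : ℝ) * (2 * p + d) / (2 * p)) : ℝ) : EReal) := by
  have : NeZero d := ⟨by lia⟩
  obtain ⟨C, hC, hentropy⟩ := exists_lpMetricEntropy_convexClass_le_of_boxes hd hp
  set e : ℝ := (d : ℝ) * (2 * p + d) / (2 * p)
  refine ⟨C * 6 ^ e, by positivity, fun a b α β hbox B hB ε hε => ?_⟩
  have hab : ∀ i, a i < b i := fun i => (hbox i).1.trans_le ((hbox i).2.1.trans (hbox i).2.2.le)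
  obtain ⟨m, hm0, hmη, hm⟩ := exists_half_pow_le
    (relDist_pos hab (fun i => (hbox i).1) fun i => (hbox i).2.2)
    (relDist_le_half hab fun i => (hbox i).2.1)
  have : NeZero m := ⟨hm0.ne'⟩
  refine (hentropy measurableSet_Icc
    (Icc_subset_interior_Icc (fun i => (hbox i).1) fun i => (hbox i).2.2)
    (fun (j : Fin d → Fin m × Bool) i => dyadicLength_pos (hab i) (j i).1)
    (fun j => Set.Icc_subset_Icc (fun i => le_dyadicStart_sub (hab i) _ (j i).2)
      fun i => dyadicStart_add_le (hab i) _ (j i).2)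
    (Icc_subset_iUnion_dyadic hab hmη) hB hε).trans (EReal.coe_le_coe_iff.2 ?_)
  have hcard : (Fintype.card (Fin d → Fin m × Bool) : ℝ) = (2 * m) ^ d := by
    simp [mul_comm]
  calc C * (ε / B) ^ (-(d : ℝ) / 2) *
        (Fintype.card (Fin d → Fin m × Bool) : ℝ) ^ (1 + (d : ℝ) / (2 * p))
      ≤ C * (ε / B) ^ (-(d : ℝ) / 2) * (6 ^ e * Real.log (1 / relDist a b α β) ^ e) := by
        rw [hcard]
        gcongr
        exact pow_rpow_le_of_le_three_mul hp m.cast_nonneg hm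
    _ = C * 6 ^ e * (ε / B) ^ (-(d : ℝ) / 2) * Real.log (1 / relDist a b α β) ^ e := by ring

end Main

theorem theorem4 (d : ℕ) (hd : 1 ≤ d) (p : ℝ) (hp : 1 ≤ p) :
    ∃ c : ℝ, 0 < c ∧
      ∀ a b α β : Fin d → ℝ, (∀ i, a i < α i ∧ α i < β i ∧ β i < b i) →
      ∀ B : ℝ, 0 < B → ∀ ε : ℝ, 0 < ε →
        lpMetricEntropy (convexClass p (Set.Icc a b) B) ε p (Set.Icc α β) ≤
          ((c * (ε / B) ^ (-(d : ℝ) / 2) *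
            Real.log (1 / relDist a b α β) ^ ((d : ℝ) * (2 * p + d) / (2 * p)) : ℝ) : EReal) := by
  obtain ⟨c, hc, hentropy⟩ := theorem4_general d hd p (by linarith)
  exact ⟨c, hc, fun a b α β hbox =>
    hentropy a b α β fun i => ⟨(hbox i).1, (hbox i).2.1.le, (hbox i).2.2⟩⟩
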